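/- **Theorem 1.4.** Conventions. $\mathbb N$ is the set of positive integers. For a finite alphabet $X$, $F(X)$ is the free group on $X$, $\|w\|$ is the length of $w\in F(X)$, and $\langle\!\langle \mathcal R\rangle\!\rangle$ is the normal closure of $\mathcal R\subseteq F(X)$. For $w\in\langle\!\langle\mathcal R\rangle\!\rangle$, $\mathrm{Area}_{\mathcal R}(w)$ is the least $\ell\ge 0$ such that $w=\prod_{i=1}^{\ell} f_i^{-1}R_i^{\varepsilon_i}f_i$ in $F(X)$ with $f_i\in F(X)$, $R_i\in\mathcal R$, $\varepsilon_i=\pm1$. The Dehn function of a finite presentation $\langle X\mid\mathcal R\rangle$ is $\delta(n)=\max\{\mathrm{Area}_{\mathcal R}(w)\mid w\in\langle\!\langle\mathcal R\rangle\!\rangle,\ \|w\|\le n\}$. Let $G$ be a group generated by a finite set $X$, and let $\mathcal S_k$ be the set of all $w\in F(X)$ with $\|w\|\le k$ that represent $1$ in $G$. The isoperimetric spectrum of $G$ with respect to $X$ is $$f_{G,X}(k,m,n)=\max\{\mathrm{Area}_{\mathcal S_m}(w)\mid w\in\langle\!\langle\mathcal S_k\rangle\!\rangle,\ \|w\|\le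 n\},\qquad k,m,n\in\mathbb N,\ m\ge k.$$ Let $\mathcal F$ be the set of all real functions on $\{(k,m,n)\in\mathbb N^3\mid m\ge k\}$ that are non-decreasing in $k$ and $n$ and non-increasing in $m$. For such functions, $f\preccurlyeq g$ means that there is $C\in\mathbb N$ with $$f(k,Cm,n)\le C\,g(Ck,m,Cn)+C\frac nm+C\qquad\text{for all }(k,m,n)\in\mathbb N^3\text{ with }m\ge Ck,$$ and $f\sim g$ means $f\preccurlyeq g$ and $g\preccurlyeq f$. A function $f\in\mathcal F$ is essentially independent of $k$ if $f\sim g$ for some $g\in\mathcal F$ that depends on $m$ and $n$ only. Statement. Let $G$ be a finitely presented group. Then $G$ has a finite presentation whose Dehn function is positive on $\mathbb N$. Moreover, for every finite generating set $X$ of $G$, the function $f_{G,X}$ belongs to $\mathcal F$ and is essentially independent of $k$, and for every finite presentation of $G$ whose Dehn function $\delta_G$ satisfies $\delta_G(m)>0$ for all $m\in\mathbb N$, $$\frac{\delta_G(n)}{\delta_G(m)}\preccurlyeq f_{G,X}(k,m,n)\preccurlyeq\frac{\delta_G(n)}{m},$$ where both bounds are regarded as functions of $(k,m,n)$ that do not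 depend on $k$. -/

import Mathlib

namespace IsoSpectrum

/-- The length `‖w‖` of (the reduced form of) an element `w` of the free group `F(X)`. -/
noncomputable def wordLength {X : Type*} (w : FreeGroup X) : ℕ :=
  letI : DecidableEq X := Classical.decEq X
  w.norm

/-- `w` is a product of exactly `l` factors of the form `f⁻¹ * r ^ ε * f` in the free group
`F(X)`, where `r ∈ R` and `ε = ±1`. -/
def IsProductOfConjugates {X : Type*} (R : Set (FreeGroup X)) (w : FreeGroup X) (l : ℕ) : Prop :=
  ∃ L : List (FreeGroup X), L.length = l ∧ L.prod = w ∧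
    ∀ g ∈ L, ∃ f : FreeGroup X, ∃ r ∈ R, ∃ ε : ℤ, (ε = 1 ∨ ε = -1) ∧ g = f⁻¹ * r ^ ε * f

/-- `Area_R(w)`: the minimal number of conjugates of elements of `R^{±1}` whose product in the free
group is `w`. It is meaningful for `w` in the normal closure of `R`, and only used for such `w`. -/
noncomputable def area {X : Type*} (R : Set (FreeGroup X)) (w : FreeGroup X) : ℕ :=
  sInf {l : ℕ | IsProductOfConjugates R w l}

/-- The Dehn function of the presentation `⟨X ∣ R⟩`: the maximum of `Area_R(w)` over all
`w ∈ ⟪R⟫` with `‖w‖ ≤ n` (a maximum over a finite set when `X` is finite). -/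
noncomputable def dehn {X : Type*} (R : Set (FreeGroup X)) (n : ℕ) : ℕ :=
  sSup {a : ℕ | ∃ w ∈ Subgroup.normalClosure R, wordLength w ≤ n ∧ area R w = a}

/-- `⟨X ∣ R⟩` is a finite presentation of `G` with the canonical map `φ : F(X) → G`. -/
def IsFinitePresentation {X G : Type*} [Group G] (φ : FreeGroup X →* G)
    (R : Set (FreeGroup X)) : Prop :=
  Finite X ∧ R.Finite ∧ Function.Surjective φ ∧ φ.ker = Subgroup.normalClosure R

/-- The set `𝒮_k` of words of length at most `k` that represent `1` in `G`. -/
def shortRelators {X G : Type*} [Group G] (φ : FreeGroup X →* G) (k : ℕ) : Set (FreeGroup X) :=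
  {w | φ w = 1 ∧ wordLength w ≤ k}

/-- The isoperimetric spectrum `f_{G,X}(k,m,n)` of the group `G` generated by `X` by means of
`φ : F(X) → G`: the maximum of `Area_{𝒮_m}(w)` over all `w ∈ ⟪𝒮_k⟫` with `‖w‖ ≤ n`.
It is only used for `k ≤ m`. -/
noncomputable def spectrum {X G : Type*} [Group G] (φ : FreeGroup X →* G) (k m n : ℕ) : ℕ :=
  sSup {a : ℕ | ∃ w ∈ Subgroup.normalClosure (shortRelators φ k),
    wordLength w ≤ n ∧ area (shortRelators φ m) w = a}

/-- The class `𝓕` of functions on the triples `(k, m, n)` of positive integers with `k ≤ m` that are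
non-decreasing in `k` and `n` and non-increasing in `m`. A function on this set of triples is
represented by a function on all triples; the values at other triples play no role. -/
def MemF (f : ℕ → ℕ → ℕ → ℝ) : Prop :=
  (∀ k k' m n : ℕ, 1 ≤ k → k ≤ k' → k' ≤ m → 1 ≤ n → f k m n ≤ f k' m n) ∧
  (∀ k m m' n : ℕ, 1 ≤ k → k ≤ m → m ≤ m' → 1 ≤ n → f k m' n ≤ f k m n) ∧
  (∀ k m n n' : ℕ, 1 ≤ k → k ≤ m → 1 ≤ n → n ≤ n' → f k m n ≤ f k m n')

/-- `f ≼ g`: for some positive integer `C`, `f(k, Cm, n) ≤ C g(Ck, m, Cn) + C n/m + C` for all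
positive integers `k, m, n` with `m ≥ Ck`. -/
def Preceq (f g : ℕ → ℕ → ℕ → ℝ) : Prop :=
  ∃ C : ℕ, 1 ≤ C ∧ ∀ k m n : ℕ, 1 ≤ k → 1 ≤ m → 1 ≤ n → C * k ≤ m →
    f k (C * m) n ≤ C * g (C * k) m (C * n) + C * ((n : ℝ) / (m : ℝ)) + C

/-- `f ∼ g`: `f ≼ g` and `g ≼ f`. -/
def Sim (f g : ℕ → ℕ → ℕ → ℝ) : Prop := Preceq f g ∧ Preceq g f

/-- `f ∈ 𝓕` is essentially independent of `k`: it is equivalent to a function in `𝓕` that depends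
on `m` and `n` only. -/
def EssentiallyIndependent (f : ℕ → ℕ → ℕ → ℝ) : Prop :=
  MemF f ∧ ∃ g : ℕ → ℕ → ℝ, MemF (fun _ m n => g m n) ∧ Sim f (fun _ m n => g m n)

/-- Over a finite alphabet there are finitely many words of bounded length, so the suprema in `dehn`
and `spectrum` are maxima. -/
theorem finite_wordLength_le {X : Type*} [Finite X] (n : ℕ) :
    {w : FreeGroup X | wordLength w ≤ n}.Finite := by
  classical
  refine Set.Finite.of_finite_image (f := FreeGroup.toWord)
    ((List.finite_length_le (X × Bool) n).subset ?_) FreeGroup.toWord_injective.injOn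
  rintro _ ⟨w, hw, rfl⟩
  have h : wordLength w = w.toWord.length := by
    unfold wordLength FreeGroup.norm
    congr!
  simpa [h] using hw

end IsoSpectrum

/-!
Let `w` be a product of `l` conjugates of relators of a finite presentation `⟨Y ∣ R⟩`. The heart of
the matter is that, for each `m`, the word `w` is also a product of `O((l + ‖w‖) / m) + 1` conjugates
of relators of length `O(m)`. Geometrically, a van Kampen diagram is cut into pieces of perimeter
`O(m)`. The proof here is purely algebraic. By `exists_short_tokens`, `w` can be spelled as a word
of `O(l + ‖w‖)` tokens, each token a generator or a relator, such that erasing the relators leaves a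
word that is trivial in the free group. Cutting this word into blocks of `m` tokens and comparing
each block with its erasure gives the decomposition (`areaLE_prod_mul_inv_prod`).

To bound the number of tokens, `w⁻¹` is added as one more relator, so that the word is trivial in the
free group both when the relators are spelled out and when they are erased. Both conditions are
invariant under cyclic permutation. If the generator tokens outnumber the letters of all relators,
then two generator tokens `x` and `x⁻¹` cancel against each other in the spelled-out word. Looking
for the letter against which `x⁻¹` cancels in the erased word, one finds in each of three cases a
rearrangement of the tokens that keeps both conditions and dispenses with one pair of generators
(`exists_shorter_tokens`).

Passing between two generating sets changes a word `w` only by `‖w‖ / m + 1` relators of length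
`O(m)`, which accounts for the term `C n / m + C` in `≼`. The upper bound `spectrum_preceq` follows at
once. For the lower bound `preceq_spectrum`, a word of maximal area is decomposed over `𝒮_m`, and
each factor has area at most `δ(Cm)`. Essential independence of `k` only uses that all relations of
`G` follow from those of some bounded length `K`.
-/

namespace IsoSpectrum

/-! ### Cancellation in marked words -/

theorem wordLength_eq_norm {X : Type*} [DecidableEq X] (w : FreeGroup X) :
    wordLength w = w.norm := by
  unfold wordLength
  congr!

theorem mk_cons_cons_not {X : Type*} (x : X) (b : Bool) (L : List (X × Bool)) :
    FreeGroup.mk ((x, b) :: (x, !b) :: L) = FreeGroup.mk L :=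
  Quot.sound FreeGroup.Red.Step.cons_not

theorem mk_cons {X : Type*} (a : X × Bool) (L : List (X × Bool)) :
    FreeGroup.mk (a :: L) = FreeGroup.mk [a] * FreeGroup.mk L := by
  rw [FreeGroup.mul_mk]; rfl

/-- `Cancels L s`: reading the marked word `L` from right to left and cancelling letters leaves the
marked word `s`. A new letter is put in front of the current word, or removed together with the
front letter if that is its inverse; either is allowed, so that `s` need not be reduced. Each letter
`(x, b)` of the free group carries a mark, which records its origin. -/
inductive Cancels {X κ : Type*} :
    List ((X × Bool) × κ) → List ((X × Bool) × κ) → Prop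
  | nil : Cancels [] []
  | push (a : (X × Bool) × κ) {L s : List ((X × Bool) × κ)} :
      Cancels L s → Cancels (a :: L) (a :: s)
  | pop (x : X) (b : Bool) (k k' : κ) {L s : List ((X × Bool) × κ)} :
      Cancels L (((x, !b), k') :: s) → Cancels (((x, b), k) :: L) s

namespace Cancels

variable {X κ : Type*} {L s : List ((X × Bool) × κ)}

theorem mk_eq (h : Cancels L s) :
    FreeGroup.mk (L.map Prod.fst) = FreeGroup.mk (s.map Prod.fst) := by
  induction h with
  | nil => rfl
  | push a _ ih => rw [List.map_cons, List.map_cons, mk_cons, ih, ← mk_cons]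
  | pop x b k k' _ ih =>
    rw [List.map_cons, mk_cons, ih, ← mk_cons, List.map_cons, mk_cons_cons_not]

theorem exists_isReduced (L : List ((X × Bool) × κ)) :
    ∃ s, Cancels L s ∧ FreeGroup.IsReduced (s.map Prod.fst) := by
  induction L with
  | nil => exact ⟨[], .nil, by simp⟩
  | cons a L ih =>
    obtain ⟨s, hs, hr⟩ := ih
    match s, hs, hr with
    | [], hs, _ => exact ⟨[a], .push a hs, by simp⟩
    | c :: s, hs, hr =>
      by_cases hc : c.1 = (a.1.1, !a.1.2)
      · obtain ⟨⟨x, b⟩, k⟩ := a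
        obtain ⟨c, k'⟩ := c
        simp only at hc
        subst hc
        refine ⟨s, .pop x b k k' hs, ?_⟩
        rw [List.map_cons] at hr
        exact hr.tail
      · refine ⟨a :: c :: s, .push a hs, ?_⟩
        rw [List.map_cons] at hr
        rw [List.map_cons, List.map_cons, FreeGroup.IsReduced, List.isChain_cons_cons]
        refine ⟨fun h => ?_, hr⟩
        by_contra hb
        exact hc (Prod.ext h.symm (by cases h1 : a.1.2 <;> cases h2 : c.1.2 <;> simp_all))

/-- A letter that survives in `s` is a letter of `L`, and the parts of `L` and of `s` in front of it
have the same value. -/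
theorem exists_split (h : Cancels L s) : ∀ {s₁ z s₂}, s = s₁ ++ z :: s₂ →
    ∃ L₁ L₂, L = L₁ ++ z :: L₂ ∧
      FreeGroup.mk (L₁.map Prod.fst) = FreeGroup.mk (s₁.map Prod.fst) := by
  induction h with
  | nil => intro s₁ z s₂ h; simp at h
  | @push a L s hL ih =>
    intro s₁ z s₂ h
    match s₁, h with
    | [], h =>
      simp only [List.nil_append, List.cons.injEq] at h
      exact ⟨[], L, by simp [h.1], rfl⟩
    | a' :: s₁, h =>
      simp only [List.cons_append, List.cons.injEq] at h
      obtain ⟨L₁, L₂, hL, hv⟩ := ih h.2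
      refine ⟨a :: L₁, L₂, by simp [hL], ?_⟩
      rw [List.map_cons, mk_cons, hv, ← mk_cons, h.1, List.map_cons]
  | @pop x b k k' L s hL ih =>
    intro s₁ z s₂ h
    obtain ⟨L₁, L₂, hL, hv⟩ := ih (s₁ := ((x, !b), k') :: s₁) (z := z) (s₂ := s₂) (by simp [h])
    refine ⟨((x, b), k) :: L₁, L₂, by simp [hL], ?_⟩
    rw [List.map_cons, mk_cons, hv, ← mk_cons, List.map_cons, mk_cons_cons_not]

/-- If no two letters with mark `true` cancel against each other, then each cancellation removes at
least as many letters with mark `false` as with mark `true`. -/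
theorem count_le {L s : List ((X × Bool) × Bool)} (h : Cancels L s)
    (hL : ∀ U x b T S, L = U ++ ((x, b), true) :: (T ++ ((x, !b), true) :: S) →
      FreeGroup.mk (T.map Prod.fst) ≠ 1) :
    L.countP (fun a => a.2) + s.countP (fun a => !a.2) ≤
      L.countP (fun a => !a.2) + s.countP (fun a => a.2) := by
  induction h with
  | nil => simp
  | @push a L s _ ih =>
    have := ih fun U x b T S h => hL (a :: U) x b T S (by simp [h])
    rcases a with ⟨a, _ | _⟩ <;> simp <;> omega
  | @pop x b k k' L s hLs ih =>
    have := ih fun U y c T S h => hL (((x, b), k) :: U) y c T S (by simp [h])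
    have hk : ¬ (k = true ∧ k' = true) := by
      rintro ⟨rfl, rfl⟩
      obtain ⟨L₁, L₂, hL', hv⟩ := hLs.exists_split (s₁ := []) rfl
      exact hL [] x b L₁ L₂ (by simp [hL']) (by rw [hv]; rfl)
    rcases k with _ | _ <;> rcases k' with _ | _ <;> simp_all <;> omega

end Cancels

theorem eq_nil_of_mk_eq_one {X : Type*} {L : List (X × Bool)} (h : FreeGroup.IsReduced L)
    (h1 : FreeGroup.mk L = 1) : L = [] := by
  classical
  rw [← h.reduce_eq, ← FreeGroup.toWord_mk, h1, FreeGroup.toWord_one]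

theorem eq_singleton_of_mk_eq {X : Type*} {L : List (X × Bool)} (h : FreeGroup.IsReduced L)
    {a : X × Bool} (h1 : FreeGroup.mk L = FreeGroup.mk [a]) : L = [a] := by
  classical
  rw [← h.reduce_eq, ← FreeGroup.toWord_mk, h1, FreeGroup.toWord_mk, FreeGroup.reduce_singleton]

/-- In a word with value `1` that has more letters marked `true` than letters marked `false`, two
letters marked `true` cancel against each other. -/
theorem exists_pair_of_count_lt {X : Type*} {L : List ((X × Bool) × Bool)}
    (h : FreeGroup.mk (L.map Prod.fst) = 1)
    (hlt : L.countP (fun a => !a.2) < L.countP (fun a => a.2)) :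
    ∃ U x b T S, L = U ++ ((x, b), true) :: (T ++ ((x, !b), true) :: S) ∧
      FreeGroup.mk (T.map Prod.fst) = 1 := by
  by_contra! hcon
  obtain ⟨s, hs, hr⟩ := Cancels.exists_isReduced L
  have := hs.count_le fun U x b T S => hcon U x b T S
  have hs0 : s = [] := List.map_eq_nil_iff.1 (eq_nil_of_mk_eq_one hr (by rw [← hs.mk_eq, h]))
  subst hs0
  simp at this
  omega

/-- In a word with value `1`, the first letter cancels against some later letter. -/
theorem exists_partner_of_mk_eq_one {X κ : Type*} {L : List ((X × Bool) × κ)} {x : X} {b : Bool}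
    (h : FreeGroup.mk ((x, b) :: L.map Prod.fst) = 1) :
    ∃ T k S, L = T ++ ((x, !b), k) :: S ∧ FreeGroup.mk (T.map Prod.fst) = 1 := by
  obtain ⟨s, hs, hr⟩ := Cancels.exists_isReduced L
  have h1 : FreeGroup.mk (s.map Prod.fst) = FreeGroup.mk [(x, !b)] := by
    rw [← hs.mk_eq]
    rw [mk_cons] at h
    rw [eq_inv_of_mul_eq_one_right h, FreeGroup.inv_mk]
    rfl
  have h2 := eq_singleton_of_mk_eq hr h1
  obtain ⟨⟨c, k⟩, rfl, hc⟩ := List.map_eq_singleton_iff.1 h2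
  obtain rfl : c = (x, !b) := hc
  obtain ⟨T, S, hL, hv⟩ := hs.exists_split (s₁ := []) rfl
  exact ⟨T, k, S, hL, by rw [hv]; rfl⟩

/-! ### Words in generators and relators -/

section Tokens

variable {X I : Type*}

/-- The value in `F(X)` of a word whose letters are generators `x ∈ X` and symbols `i ∈ I`, where the
symbol `i` stands for `σ i`. With `σ = ρ` a family of relators this is the spelled-out word; with
`σ = 1` it is the word from which all relators have been erased. -/
noncomputable def evalTokens (σ : I → FreeGroup X) (p : List ((X ⊕ I) × Bool)) : FreeGroup X :=
  FreeGroup.lift (Sum.elim FreeGroup.of σ) (FreeGroup.mk p)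

theorem evalTokens_append (σ : I → FreeGroup X) (p q : List ((X ⊕ I) × Bool)) :
    evalTokens σ (p ++ q) = evalTokens σ p * evalTokens σ q := by
  rw [evalTokens, ← FreeGroup.mul_mk, map_mul]; rfl

theorem evalTokens_cons (σ : I → FreeGroup X) (t : (X ⊕ I) × Bool) (q : List ((X ⊕ I) × Bool)) :
    evalTokens σ (t :: q) = evalTokens σ [t] * evalTokens σ q :=
  evalTokens_append σ [t] q

theorem evalTokens_inl (σ : I → FreeGroup X) (x : X) (b : Bool) :
    evalTokens σ [(Sum.inl x, b)] = FreeGroup.mk [(x, b)] := by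
  cases b <;> simp [evalTokens, FreeGroup.of, FreeGroup.invRev]

theorem evalTokens_inr (σ : I → FreeGroup X) (i : I) (b : Bool) :
    evalTokens σ [(Sum.inr i, b)] = if b then σ i else (σ i)⁻¹ := by
  cases b <;> simp [evalTokens]

theorem evalTokens_cons_inl (σ : I → FreeGroup X) (x : X) (b : Bool)
    (q : List ((X ⊕ I) × Bool)) :
    evalTokens σ ((Sum.inl x, b) :: q) = FreeGroup.mk [(x, b)] * evalTokens σ q := by
  rw [evalTokens_cons, evalTokens_inl]

theorem evalTokens_cons_inl_not (σ : I → FreeGroup X) (x : X) (b : Bool)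
    (q : List ((X ⊕ I) × Bool)) :
    evalTokens σ ((Sum.inl x, !b) :: q) = (FreeGroup.mk [(x, b)])⁻¹ * evalTokens σ q := by
  rw [evalTokens_cons, evalTokens_inl, FreeGroup.inv_mk]; rfl

theorem evalTokens_map_inl (σ : I → FreeGroup X) (L : List (X × Bool)) :
    evalTokens σ (L.map fun a => (Sum.inl a.1, a.2)) = FreeGroup.mk L := by
  induction L with
  | nil => rfl
  | cons a L ih => rw [List.map_cons, evalTokens_cons_inl, ih, ← mk_cons]

theorem length_eq_count_add_count (p : List ((X ⊕ I) × Bool)) :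
    p.length = p.countP (fun t => t.1.isLeft) + p.countP (fun t => t.1.isRight) := by
  rw [List.length_eq_countP_add_countP (fun t => t.1.isLeft)]
  simp

/-- The letters of `F(X)` by which a token contributes to `evalTokens σ`. The mark is `true` for a
generator and `false` for a letter of the reduced word of a relator. -/
noncomputable def expand [DecidableEq X] (σ : I → FreeGroup X) :
    (X ⊕ I) × Bool → List ((X × Bool) × Bool)
  | (Sum.inl x, b) => [((x, b), true)]
  | (Sum.inr i, b) => (if b then σ i else (σ i)⁻¹).toWord.map fun a => (a, false)

variable [DecidableEq X]

theorem mk_expand (σ : I → FreeGroup X) (p : List ((X ⊕ I) × Bool)) :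
    FreeGroup.mk ((p.flatMap (expand σ)).map Prod.fst) = evalTokens σ p := by
  induction p with
  | nil => rfl
  | cons t p ih =>
    rw [List.flatMap_cons, List.map_append, ← FreeGroup.mul_mk, ih, evalTokens_cons]
    congr 1
    rcases t with ⟨x | i, b⟩
    · rw [evalTokens_inl]; rfl
    · rw [evalTokens_inr]
      simp [expand, Function.comp_def, FreeGroup.mk_toWord]

theorem exists_split_of_expand_eq (σ : I → FreeGroup X) :
    ∀ {p : List ((X ⊕ I) × Bool)} {U x b S}, p.flatMap (expand σ) = U ++ ((x, b), true) :: S →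
      ∃ P Q, p = P ++ (Sum.inl x, b) :: Q ∧ P.flatMap (expand σ) = U ∧
        Q.flatMap (expand σ) = S := by
  intro p
  induction p with
  | nil => intro U x b S h; simp at h
  | cons t p ih =>
    intro U x b S h
    rw [List.flatMap_cons, List.append_eq_append_iff] at h
    rcases h with ⟨V, rfl, hV⟩ | ⟨V, hV, hS⟩
    · obtain ⟨P, Q, rfl, rfl, rfl⟩ := ih hV
      exact ⟨t :: P, Q, rfl, rfl, rfl⟩
    · match V, hV, hS with
      | [], hV, hS =>
        obtain ⟨P, Q, rfl, hP, rfl⟩ := ih (U := []) hS.symm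
        refine ⟨t :: P, Q, rfl, ?_, rfl⟩
        rw [List.flatMap_cons, hP, hV, List.append_nil, List.append_nil]
      | v :: V, hV, hS =>
        obtain ⟨rfl, rfl⟩ : ((x, b), true) = v ∧ S = V ++ p.flatMap (expand σ) := by simpa using hS
        rcases t with ⟨y | i, c⟩
        · have h1 : U = [] ∧ V = [] ∧ (y, c) = (x, b) := by
            have hl := congrArg List.length hV
            simp [expand] at hl
            obtain rfl := List.length_eq_zero_iff.1 (show U.length = 0 by omega)
            obtain rfl := List.length_eq_zero_iff.1 (show V.length = 0 by omega)
            simpa [expand] using hV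
          obtain ⟨rfl, rfl, h1⟩ := h1
          cases h1
          exact ⟨[], p, rfl, rfl, rfl⟩
        · have : ((x, b), true) ∈ expand σ (Sum.inr i, c) := by rw [hV]; simp
          simp [expand] at this

/-- The total length of the relators that occur in a word of tokens. -/
def relatorLength (σ : I → FreeGroup X) (p : List ((X ⊕ I) × Bool)) : ℕ :=
  (p.map fun t => t.1.elim (fun _ => 0) fun i => (σ i).norm).sum

theorem count_expand (σ : I → FreeGroup X) (p : List ((X ⊕ I) × Bool)) :
    (p.flatMap (expand σ)).countP (fun a => a.2) = p.countP (fun t => t.1.isLeft) ∧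
    (p.flatMap (expand σ)).countP (fun a => !a.2) = relatorLength σ p := by
  induction p with
  | nil => simp [relatorLength]
  | cons t p ih =>
    rw [List.flatMap_cons, List.countP_append, List.countP_append, ih.1, ih.2]
    rcases t with ⟨x | i, b⟩
    · simp [expand, relatorLength, List.countP_cons, add_comm]
    · have h : (if b then σ i else (σ i)⁻¹).toWord.length = (σ i).norm := by
        cases b
        · exact FreeGroup.norm_inv_eq
        · rfl
      simp [expand, relatorLength, List.countP_map, Function.comp_def, h]

/-- If a closed word has more generators than letters in its relators, then two of its generators
cancel against each other. -/
theorem exists_letter_pair (ρ : I → FreeGroup X) {p : List ((X ⊕ I) × Bool)}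
    (h : evalTokens ρ p = 1) (hlt : relatorLength ρ p < p.countP fun t => t.1.isLeft) :
    ∃ U x b T S, p = U ++ (Sum.inl x, b) :: (T ++ (Sum.inl x, !b) :: S) ∧
      evalTokens ρ T = 1 := by
  obtain ⟨U, x, b, T, S, hp, hT⟩ := exists_pair_of_count_lt (L := p.flatMap (expand ρ))
    (by rw [mk_expand, h]) (by rwa [(count_expand ρ p).1, (count_expand ρ p).2])
  obtain ⟨P, Q, rfl, -, hQ⟩ := exists_split_of_expand_eq ρ hp
  obtain ⟨T', S', rfl, rfl, -⟩ := exists_split_of_expand_eq ρ hQ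
  exact ⟨P, x, b, T', S', rfl, by rw [← mk_expand, hT]⟩

/-- If erasing the relators gives `1`, then the first generator cancels, after the erasure, against some
later generator. -/
theorem exists_erased_partner {p : List ((X ⊕ I) × Bool)} {x : X} {b : Bool}
    (h : evalTokens (1 : I → FreeGroup X) ((Sum.inl x, b) :: p) = 1) :
    ∃ T S, p = T ++ (Sum.inl x, !b) :: S ∧ evalTokens (1 : I → FreeGroup X) T = 1 := by
  rw [evalTokens_cons, evalTokens_inl, ← mk_expand, ← mk_cons] at h
  obtain ⟨T, k, S, hL, hT⟩ := exists_partner_of_mk_eq_one h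
  have hk : k = true := by
    have : ((x, !b), k) ∈ p.flatMap (expand (1 : I → FreeGroup X)) := by rw [hL]; simp
    obtain ⟨⟨y | i, c⟩, -, ht⟩ := List.mem_flatMap.1 this
    · simp [expand] at ht
      exact ht.2
    · simp [expand] at ht
  subst hk
  obtain ⟨P, Q, rfl, rfl, -⟩ := exists_split_of_expand_eq _ hL
  exact ⟨P, Q, rfl, by rw [← mk_expand, hT]⟩

/-- The shortening step. Suppose that a word of tokens is trivial both when its relators are spelled
out and when they are erased. If its generators outnumber the letters of its relators, then its
tokens can be rearranged so that a cancelling pair of generators becomes superfluous: without this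
pair, both values are still trivial. -/
theorem exists_shorter_tokens (ρ : I → FreeGroup X) {p : List ((X ⊕ I) × Bool)}
    (h : evalTokens ρ p = 1) (h1 : evalTokens (1 : I → FreeGroup X) p = 1)
    (hlt : relatorLength ρ p < p.countP fun t => t.1.isLeft) :
    ∃ x b q, p.Perm ((Sum.inl x, b) :: (Sum.inl x, !b) :: q) ∧ evalTokens ρ q = 1 ∧
      evalTokens (1 : I → FreeGroup X) q = 1 := by
  obtain ⟨U, x, b, T, S', rfl, hT⟩ := exists_letter_pair ρ h hlt
  -- Both conditions are invariant under cyclic permutation, so the word may be read as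
  -- `x⁻¹ S x T`, where `S` and `T` are trivial as spelled-out words.
  obtain ⟨S, hS⟩ : ∃ S, S = S' ++ U := ⟨_, rfl⟩
  have key : ∀ σ : I → FreeGroup X,
      evalTokens σ (U ++ (Sum.inl x, b) :: (T ++ (Sum.inl x, !b) :: S')) = 1 →
      evalTokens σ ((Sum.inl x, !b) :: (S ++ (Sum.inl x, b) :: T)) = 1 := by
    intro σ hσ
    have e : U ++ (Sum.inl x, b) :: (T ++ (Sum.inl x, !b) :: S') =
      (U ++ (Sum.inl x, b) :: T) ++ (Sum.inl x, !b) :: S' := by simp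
    have e' : (Sum.inl x, !b) :: (S ++ (Sum.inl x, b) :: T) =
      ((Sum.inl x, !b) :: S') ++ (U ++ (Sum.inl x, b) :: T) := by simp [hS]
    rw [e, evalTokens_append] at hσ
    rw [e', evalTokens_append]
    exact mul_eq_one_comm.1 hσ
  replace h := key ρ h
  replace h1 := key 1 h1
  have hperm : (U ++ (Sum.inl x, b) :: (T ++ (Sum.inl x, !b) :: S')).Perm
      ((Sum.inl x, b) :: (Sum.inl x, !b) :: (S ++ T)) := by
    simp only [hS, ← Multiset.coe_eq_coe, ← Multiset.coe_add, ← Multiset.cons_coe,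
      ← Multiset.singleton_add]
    abel
  -- After the erasure `x⁻¹` cancels against some `x`, with `V` trivial in between. This is the
  -- displayed `x`, or it lies in `T`, or it lies in `S`.
  obtain ⟨V, W, hVW, hV⟩ := exists_erased_partner h1
  rw [Bool.not_not] at hVW
  rw [evalTokens_cons_inl_not] at h h1
  simp only [evalTokens_cons_inl, evalTokens_append, hT, mul_one] at h h1
  have hSρ : evalTokens ρ S = 1 := by
    rw [inv_mul_eq_one] at h
    exact mul_eq_right.1 h.symm
  obtain ⟨q, hq, hqρ, hq1⟩ : ∃ q, (S ++ T).Perm q ∧ evalTokens ρ q = 1 ∧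
      evalTokens (1 : I → FreeGroup X) q = 1 := by
    rw [List.append_eq_append_iff] at hVW
    rcases hVW with ⟨Z, rfl, hZ⟩ | ⟨Z, rfl, hZ⟩
    · match Z, hZ with
      | [], hZ =>
        obtain rfl : T = W := by simpa using hZ
        rw [List.append_nil] at hV
        refine ⟨S ++ T, .refl _, ?_, ?_⟩ <;> rw [evalTokens_append]
        · rw [hSρ, hT, one_mul]
        · simpa [hV, -FreeGroup.inv_mk] using h1
      | z :: Z, hZ =>
        obtain ⟨rfl, rfl⟩ : (Sum.inl x, b) = z ∧ T = Z ++ (Sum.inl x, b) :: W := by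
          simpa using hZ
        -- Here `T = Z x W`; the erased values of `S x Z` and of `W` are trivial.
        refine ⟨S ++ (Sum.inl x, b) :: (W ++ Z), ?_, ?_, ?_⟩
        · simp only [← Multiset.coe_eq_coe, ← Multiset.coe_add, ← Multiset.cons_coe,
            ← Multiset.singleton_add]
          abel
        all_goals
          simp only [evalTokens_cons_inl, evalTokens_append] at h1 hT hV ⊢
        · rw [hSρ, one_mul, ← mul_assoc]
          exact mul_eq_one_comm.1 hT
        · have hW : evalTokens (1 : I → FreeGroup X) W = 1 := by
            have e := mul_eq_one_iff_eq_inv.1 hV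
            rw [e] at h1
            simpa [mul_assoc, -FreeGroup.inv_mk] using h1
          rw [hW, one_mul, hV]
    · match Z, hZ with
      | [], hZ =>
        obtain rfl : T = W := by simpa using hZ.symm
        rw [List.append_nil] at h1 hSρ ⊢
        refine ⟨V ++ T, .refl _, ?_, ?_⟩ <;> rw [evalTokens_append]
        · rw [hSρ, hT, one_mul]
        · simpa [hV, -FreeGroup.inv_mk] using h1
      | z :: Z, hZ =>
        obtain ⟨rfl, rfl⟩ : (Sum.inl x, b) = z ∧ W = Z ++ (Sum.inl x, b) :: T := by
          simpa using hZ
        -- Here `S = V x Z`; the erased values of `V` and of `Z x T` are trivial.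
        refine ⟨V ++ (Sum.inl x, b) :: (T ++ Z), ?_, ?_, ?_⟩
        · simp only [← Multiset.coe_eq_coe, ← Multiset.coe_add, ← Multiset.cons_coe,
            ← Multiset.singleton_add]
          abel
        all_goals
          simp only [evalTokens_cons_inl, evalTokens_append] at h1 hSρ ⊢
        · rw [hT, one_mul, hSρ]
        · rw [hV, one_mul] at h1 ⊢
          rw [mul_eq_one_comm]
          simp only [mul_assoc] at h1 ⊢
          rw [inv_mul_eq_one] at h1
          have e := mul_eq_left.1 h1.symm
          rw [← mul_assoc] at e
          exact mul_eq_one_comm.1 e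
  exact ⟨x, b, q, hperm.trans ((hq.cons _).cons _), hqρ, hq1⟩

/-- Repeated shortening: up to generators `Q` that are discarded, the tokens can be rearranged into a
word with both values trivial in which the generators do not outnumber the letters of the relators. -/
theorem exists_few_letters (ρ : I → FreeGroup X) (p : List ((X ⊕ I) × Bool))
    (h : evalTokens ρ p = 1) (h1 : evalTokens (1 : I → FreeGroup X) p = 1) :
    ∃ Q q, p.Perm (Q ++ q) ∧ (∀ t ∈ Q, t.1.isLeft) ∧ evalTokens ρ q = 1 ∧
      evalTokens (1 : I → FreeGroup X) q = 1 ∧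
      q.countP (fun t => t.1.isLeft) ≤ relatorLength ρ q := by
  induction hN : p.length using Nat.strong_induction_on generalizing p with
  | _ N ih =>
    by_cases hlt : relatorLength ρ p < p.countP fun t => t.1.isLeft
    · obtain ⟨x, b, q, hp, hq, hq1⟩ := exists_shorter_tokens ρ h h1 hlt
      have hlen := hp.length_eq
      simp only [List.length_cons] at hlen
      obtain ⟨Q, q', hp', hQ, h'⟩ := ih q.length (by omega) q hq hq1 rfl
      refine ⟨(Sum.inl x, b) :: (Sum.inl x, !b) :: Q, q',
        hp.trans ((hp'.cons _).cons _), ?_, h'⟩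
      simpa using hQ
    · exact ⟨[], p, .refl _, by simp, h, h1, not_lt.1 hlt⟩

theorem relatorLength_append (ρ : I → FreeGroup X) (p q : List ((X ⊕ I) × Bool)) :
    relatorLength ρ (p ++ q) = relatorLength ρ p + relatorLength ρ q := by
  simp [relatorLength]

theorem relatorLength_le (ρ : I → FreeGroup X) {M : ℕ} {p : List ((X ⊕ I) × Bool)}
    (hp : ∀ i b, (Sum.inr i, b) ∈ p → (ρ i).norm ≤ M) :
    relatorLength ρ p ≤ M * p.countP fun t => t.1.isRight := by
  induction p with
  | nil => simp [relatorLength]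
  | cons t p ih =>
    have := ih fun i b h => hp i b (List.mem_cons_of_mem _ h)
    have e : relatorLength ρ (t :: p) = relatorLength ρ [t] + relatorLength ρ p :=
      relatorLength_append ρ [t] p
    rw [e]
    rcases t with ⟨x | i, b⟩
    · simpa [relatorLength, List.countP_cons] using this
    · have := hp i b (by simp)
      simp only [relatorLength, List.map_cons, Sum.elim_inr, List.map_nil, List.sum_cons,
        List.sum_nil, List.countP_cons, Sum.isRight_inr, if_true, mul_add] at *
      omega

theorem relatorLength_of_isLeft (ρ : I → FreeGroup X) {p : List ((X ⊕ I) × Bool)}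
    (hp : ∀ t ∈ p, t.1.isLeft) : relatorLength ρ p = 0 := by
  refine Nat.eq_zero_of_le_zero ((relatorLength_le ρ (M := 0) fun i b h => ?_).trans (by simp))
  simpa using hp _ h

theorem exists_tokens_of_conjugate {R : Set (FreeGroup X)} (f : FreeGroup X) {r : FreeGroup X}
    (hr : r ∈ R) (b : Bool) :
    ∃ p : List ((X ⊕ FreeGroup X) × Bool),
      evalTokens id p = f⁻¹ * (if b then r else r⁻¹) * f ∧
      evalTokens (1 : FreeGroup X → FreeGroup X) p = 1 ∧
      p.countP (fun t => t.1.isRight) = 1 ∧ ∀ i c, (Sum.inr i, c) ∈ p → i ∈ R := by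
  refine ⟨f⁻¹.toWord.map (fun a => (Sum.inl a.1, a.2)) ++ [(Sum.inr r, b)] ++
    f.toWord.map (fun a => (Sum.inl a.1, a.2)), ?_, ?_, ?_, ?_⟩
  · simp only [evalTokens_append, evalTokens_map_inl, FreeGroup.mk_toWord, evalTokens_inr, id]
  · simp only [evalTokens_append, evalTokens_map_inl, FreeGroup.mk_toWord, evalTokens_inr]
    simp
  · simp [List.countP_cons, List.countP_map, Function.comp_def]
  · intro i c h
    simp only [List.mem_append, List.mem_map, List.mem_singleton, Prod.mk.injEq,
      reduceCtorEq, false_and, and_false, exists_false, false_or, or_false, Sum.inr.injEq] at h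
    exact h.1 ▸ hr

theorem exists_tokens_of_isProductOfConjugates {R : Set (FreeGroup X)} {w : FreeGroup X} {l : ℕ}
    (h : IsProductOfConjugates R w l) :
    ∃ p : List ((X ⊕ FreeGroup X) × Bool), evalTokens id p = w ∧
      evalTokens (1 : FreeGroup X → FreeGroup X) p = 1 ∧
      p.countP (fun t => t.1.isRight) = l ∧ ∀ i c, (Sum.inr i, c) ∈ p → i ∈ R := by
  obtain ⟨L, rfl, rfl, hL⟩ := h
  induction L with
  | nil => exact ⟨[], rfl, rfl, rfl, by simp⟩
  | cons g L ih =>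
    obtain ⟨p, hp, hp1, hpc, hpR⟩ := ih fun g hg => hL g (List.mem_cons_of_mem _ hg)
    obtain ⟨f, r, hr, ε, hε, rfl⟩ := hL g List.mem_cons_self
    obtain ⟨q, hq, hq1, hqc, hqR⟩ := exists_tokens_of_conjugate f hr (decide (ε = 1))
    refine ⟨q ++ p, ?_, ?_, ?_, ?_⟩
    · rw [evalTokens_append, hp, hq, List.prod_cons]
      rcases hε with rfl | rfl <;> simp
    · rw [evalTokens_append, hp1, hq1, one_mul]
    · rw [List.countP_append, hpc, hqc, List.length_cons, add_comm]
    · intro i c h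
      exact (List.mem_append.1 h).elim (hqR i c) (hpR i c)

end Tokens

/-- A substitute for van Kampen diagrams. A product `w` of `l` conjugates of relators can be spelled by a
word of `O(l + ‖w‖)` tokens, each a generator or a relator, that becomes trivial when the relators
are erased; no bound on the lengths of the conjugating elements is needed. -/
theorem exists_short_tokens {X : Type*} {R : Set (FreeGroup X)} {w : FreeGroup X} {l M : ℕ}
    (h : IsProductOfConjugates R w l) (hM : ∀ r ∈ R, wordLength r ≤ M) :
    ∃ p : List ((X ⊕ FreeGroup X) × Bool), evalTokens id p = w ∧
      evalTokens (1 : FreeGroup X → FreeGroup X) p = 1 ∧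
      p.length ≤ (M + 1) * l + wordLength w ∧ ∀ i c, (Sum.inr i, c) ∈ p → i ∈ R := by
  classical
  simp only [wordLength_eq_norm] at *
  obtain ⟨p, hp, hp1, hpc, hpR⟩ := exists_tokens_of_isProductOfConjugates h
  -- Adding `w⁻¹` as one more relator makes the word closed. After the shortening, `w⁻¹` is rotated
  -- to the end and removed.
  obtain ⟨Q, q, hperm, hQ, hq, hq1, hle⟩ := exists_few_letters id (p ++ [(Sum.inr w, false)])
    (by rw [evalTokens_append, hp, evalTokens_inr]; simp)
    (by rw [evalTokens_append, hp1, evalTokens_inr]; simp)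
  have hw : (Sum.inr w, false) ∈ q := by
    have : (Sum.inr w, false) ∈ Q ++ q := hperm.subset (by simp)
    rcases List.mem_append.1 this with h | h
    · simpa using hQ _ h
    · exact h
  obtain ⟨P₁, P₂, rfl⟩ := List.append_of_mem hw
  have hperm' : p.Perm (Q ++ (P₂ ++ P₁)) := by
    refine List.Perm.cons_inv (a := (Sum.inr w, false)) ?_
    simp only [← Multiset.coe_eq_coe, ← Multiset.coe_add, ← Multiset.cons_coe,
            ← Multiset.singleton_add, Multiset.coe_nil] at hperm ⊢
    rw [add_comm, ← add_zero {_}, hperm]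
    abel
  have hrel : relatorLength id (P₁ ++ (Sum.inr w, false) :: P₂) = relatorLength id p + w.norm := by
    have := (hperm.map fun t => t.1.elim (fun _ => 0) fun i => (id i).norm).sum_eq
    change relatorLength id _ = relatorLength id _ at this
    rw [relatorLength_append, relatorLength_append, relatorLength_of_isLeft id hQ, zero_add] at this
    rw [← this]
    simp [relatorLength]
  have hrelp : relatorLength id p ≤ M * l := by
    rw [← hpc]
    exact relatorLength_le id fun i b hi => hM i (hpR i b hi)
  have hright : (P₂ ++ P₁).countP (fun t => t.1.isRight) ≤ l := by
    rw [← hpc, hperm'.countP_eq, List.countP_append (l₁ := Q)]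
    exact Nat.le_add_left _ _
  refine ⟨P₂ ++ P₁, ?_, ?_, ?_, fun i c hi => hpR i c (hperm'.symm.subset ?_)⟩
  · rw [evalTokens_append, evalTokens_cons, evalTokens_inr] at hq
    rw [evalTokens_append]
    simp only [Bool.false_eq_true, if_false, id] at hq
    rw [mul_eq_one_comm, mul_assoc, inv_mul_eq_one] at hq
    exact hq.symm
  · rw [evalTokens_append, evalTokens_cons, evalTokens_inr] at hq1
    rw [evalTokens_append]
    simp only [Bool.false_eq_true, if_false, Pi.one_apply, inv_one, one_mul] at hq1
    exact mul_eq_one_comm.1 hq1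
  · rw [length_eq_count_add_count, add_mul, one_mul]
    have hl : (P₂ ++ P₁).countP (fun t => t.1.isLeft) ≤ M * l + w.norm := by
      refine le_trans ?_ (hle.trans (hrel.le.trans (Nat.add_le_add_right hrelp _)))
      simp only [List.countP_append, List.countP_cons]
      omega
    omega
  · exact List.mem_append_right _ hi

/-! ### Area bounds -/

/-- `w` is a product of at most `l` conjugates of elements of `R` and their inverses. Unlike
`area R w ≤ l`, this implies that `w` is in the normal closure of `R`. -/
def AreaLE {X : Type*} (R : Set (FreeGroup X)) (w : FreeGroup X) (l : ℕ) : Prop :=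
  ∃ l' ≤ l, IsProductOfConjugates R w l'

namespace AreaLE

variable {X Y : Type*} {R S : Set (FreeGroup X)} {u w : FreeGroup X} {k l : ℕ}

theorem one (R : Set (FreeGroup X)) : AreaLE R 1 0 :=
  ⟨0, le_rfl, [], rfl, rfl, by simp⟩

theorem mono (h : AreaLE R w k) (hkl : k ≤ l) : AreaLE R w l :=
  let ⟨l', hl, h'⟩ := h
  ⟨l', hl.trans hkl, h'⟩

theorem subset (h : AreaLE R w l) (hRS : R ⊆ S) : AreaLE S w l := by
  obtain ⟨l', hl, L, hL, hw, h⟩ := h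
  refine ⟨l', hl, L, hL, hw, fun g hg => ?_⟩
  obtain ⟨f, r, hr, h⟩ := h g hg
  exact ⟨f, r, hRS hr, h⟩

theorem mul (hu : AreaLE R u k) (hw : AreaLE R w l) : AreaLE R (u * w) (k + l) := by
  obtain ⟨k', hk, L, hL, rfl, hLR⟩ := hu
  obtain ⟨l', hl, L', hL', rfl, hLR'⟩ := hw
  exact ⟨k' + l', add_le_add hk hl, L ++ L', by simp [hL, hL'], List.prod_append,
    fun g hg => (List.mem_append.1 hg).elim (hLR g) (hLR' g)⟩

theorem conj (h : AreaLE R w l) (g : FreeGroup X) : AreaLE R (g⁻¹ * w * g) l := by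
  obtain ⟨l', hl, L, hL, rfl, hLR⟩ := h
  refine ⟨l', hl, L.map (MulAut.conj g⁻¹), by simpa using hL, ?_, fun a ha => ?_⟩
  · rw [← map_list_prod]
    simp
  · obtain ⟨b, hb, rfl⟩ := List.mem_map.1 ha
    obtain ⟨f, r, hr, ε, hε, rfl⟩ := hLR b hb
    exact ⟨f * g, r, hr, ε, hε, by simp [mul_assoc]⟩

theorem inv (h : AreaLE R w l) : AreaLE R w⁻¹ l := by
  obtain ⟨l', hl, L, hL, rfl, hLR⟩ := h
  refine ⟨l', hl, (L.map (·⁻¹)).reverse, by simpa using hL, (List.prod_inv_reverse L).symm,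
    fun a ha => ?_⟩
  obtain ⟨b, hb, rfl⟩ := List.mem_map.1 (List.mem_reverse.1 ha)
  obtain ⟨f, r, hr, ε, hε, rfl⟩ := hLR b hb
  refine ⟨f, r, hr, -ε, ?_, by simp [mul_assoc]⟩
  rcases hε with rfl | rfl <;> simp

theorem of_mem (h : w ∈ R) : AreaLE R w 1 :=
  ⟨1, le_rfl, [w], rfl, by simp, fun g hg => ⟨1, w, h, 1, by simp, by simpa using hg⟩⟩

theorem map (h : AreaLE R w l) (α : FreeGroup X →* FreeGroup Y) : AreaLE (α '' R) (α w) l := by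
  obtain ⟨l', hl, L, hL, rfl, hLR⟩ := h
  refine ⟨l', hl, L.map α, by simpa using hL, (map_list_prod α L).symm, fun a ha => ?_⟩
  obtain ⟨b, hb, rfl⟩ := List.mem_map.1 ha
  obtain ⟨f, r, hr, ε, hε, rfl⟩ := hLR b hb
  exact ⟨α f, α r, ⟨r, hr, rfl⟩, ε, hε, by simp⟩

theorem trans (h : AreaLE S w l) (hSR : ∀ s ∈ S, AreaLE R s k) : AreaLE R w (l * k) := by
  obtain ⟨l', hl, L, rfl, rfl, hLS⟩ := h
  refine mono (k := L.length * k) ?_ (Nat.mul_le_mul_right k hl)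
  clear hl
  induction L with
  | nil => exact (one R).mono (Nat.zero_le _)
  | cons g L ih =>
    obtain ⟨f, s, hs, ε, hε, rfl⟩ := hLS g List.mem_cons_self
    rw [List.prod_cons, List.length_cons, add_mul, one_mul, add_comm]
    refine mul (conj ?_ f) (ih fun g hg => hLS g (List.mem_cons_of_mem _ hg))
    rcases hε with rfl | rfl
    · rw [zpow_one]; exact hSR s hs
    · rw [zpow_neg_one]; exact (hSR s hs).inv

theorem mem_normalClosure (h : AreaLE R w l) : w ∈ Subgroup.normalClosure R := by
  obtain ⟨l', hl, L, hL, rfl, hLR⟩ := h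
  refine Subgroup.list_prod_mem _ fun g hg => ?_
  obtain ⟨f, r, hr, ε, hε, rfl⟩ := hLR g hg
  have := Subgroup.normalClosure_normal.conj_mem _
    (Subgroup.zpow_mem _ (Subgroup.subset_normalClosure hr) ε) f⁻¹
  simpa using this

theorem exists_of_mem_normalClosure (h : w ∈ Subgroup.normalClosure R) : ∃ l, AreaLE R w l := by
  induction h using Subgroup.closure_induction with
  | mem x hx =>
    obtain ⟨r, hr, hx⟩ := Group.mem_conjugatesOfSet_iff.1 hx
    obtain ⟨c, rfl⟩ := isConj_iff.1 hx
    exact ⟨1, by simpa using (of_mem hr).conj c⁻¹⟩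
  | one => exact ⟨0, one R⟩
  | mul x y _ _ hx hy => exact ⟨_, hx.choose_spec.mul hy.choose_spec⟩
  | inv x _ hx => exact ⟨_, hx.choose_spec.inv⟩

theorem area_le (h : AreaLE R w l) : area R w ≤ l :=
  let ⟨_, hl, h'⟩ := h
  (Nat.sInf_le h').trans hl

end AreaLE

variable {X Y G : Type*} [Group G]

theorem isProductOfConjugates_area {R : Set (FreeGroup X)} {w : FreeGroup X}
    (h : w ∈ Subgroup.normalClosure R) : IsProductOfConjugates R w (area R w) :=
  let ⟨_, l, _, hl⟩ := AreaLE.exists_of_mem_normalClosure h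
  Nat.sInf_mem (s := {l | IsProductOfConjugates R w l}) ⟨l, hl⟩

theorem areaLE_area {R : Set (FreeGroup X)} {w : FreeGroup X}
    (h : w ∈ Subgroup.normalClosure R) : AreaLE R w (area R w) :=
  ⟨_, le_rfl, isProductOfConjugates_area h⟩

theorem area_pos {R : Set (FreeGroup X)} {w : FreeGroup X}
    (h : w ∈ Subgroup.normalClosure R) (hw : w ≠ 1) : 0 < area R w := by
  refine Nat.pos_of_ne_zero fun h0 => hw ?_
  obtain ⟨L, hL, rfl, -⟩ := isProductOfConjugates_area h
  rw [h0, List.length_eq_zero_iff] at hL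
  rw [hL, List.prod_nil]

theorem area_le_dehn [Finite X] {R : Set (FreeGroup X)} {w : FreeGroup X} {n : ℕ}
    (h : w ∈ Subgroup.normalClosure R) (hn : wordLength w ≤ n) : area R w ≤ dehn R n := by
  refine le_csSup (Set.Finite.bddAbove ?_) ⟨w, h, hn, rfl⟩
  refine ((finite_wordLength_le (X := X) n).image (area R)).subset ?_
  rintro _ ⟨w, -, hw, rfl⟩
  exact ⟨w, hw, rfl⟩

theorem dehn_le {R : Set (FreeGroup X)} {n B : ℕ}
    (h : ∀ w ∈ Subgroup.normalClosure R, wordLength w ≤ n → area R w ≤ B) : dehn R n ≤ B := by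
  refine csSup_le' ?_
  rintro _ ⟨w, hw, hn, rfl⟩
  exact h w hw hn

theorem dehn_mono [Finite X] (R : Set (FreeGroup X)) : Monotone (dehn R) :=
  fun _ _ hnn => dehn_le fun _ hw hn => area_le_dehn hw (hn.trans hnn)

theorem area_le_spectrum [Finite X] (φ : FreeGroup X →* G) {k n : ℕ} (m : ℕ) {w : FreeGroup X}
    (h : w ∈ Subgroup.normalClosure (shortRelators φ k)) (hn : wordLength w ≤ n) :
    area (shortRelators φ m) w ≤ spectrum φ k m n := by
  refine le_csSup (Set.Finite.bddAbove ?_) ⟨w, h, hn, rfl⟩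
  refine ((finite_wordLength_le (X := X) n).image (area (shortRelators φ m))).subset ?_
  rintro _ ⟨w, -, hw, rfl⟩
  exact ⟨w, hw, rfl⟩

theorem spectrum_le {φ : FreeGroup X →* G} {k m n B : ℕ}
    (h : ∀ w ∈ Subgroup.normalClosure (shortRelators φ k), wordLength w ≤ n →
      area (shortRelators φ m) w ≤ B) : spectrum φ k m n ≤ B := by
  refine csSup_le' ?_
  rintro _ ⟨w, hw, hn, rfl⟩
  exact h w hw hn

theorem shortRelators_mono (φ : FreeGroup X →* G) : Monotone (shortRelators φ) :=
  fun _ _ hkk _ hw => ⟨hw.1, hw.2.trans hkk⟩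

theorem normalClosure_shortRelators_le_ker (φ : FreeGroup X →* G) (k : ℕ) :
    Subgroup.normalClosure (shortRelators φ k) ≤ φ.ker :=
  Subgroup.normalClosure_le_normal fun _ hw => hw.1

/-- The condition `k' ≤ m'` ensures that the areas on the right are areas of words in the normal closure
of `𝒮_{m'}`. -/
theorem spectrum_le_spectrum [Finite X] (φ : FreeGroup X →* G) {k k' m m' n n' : ℕ}
    (hk : Subgroup.normalClosure (shortRelators φ k) ≤
      Subgroup.normalClosure (shortRelators φ k'))
    (hkm : k' ≤ m') (hm : m' ≤ m) (hn : n ≤ n') : spectrum φ k m n ≤ spectrum φ k' m' n' := by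
  refine spectrum_le fun w hw hwn => le_trans ?_ (area_le_spectrum φ m' (hk hw) (hwn.trans hn))
  exact ((areaLE_area (Subgroup.normalClosure_mono (shortRelators_mono φ hkm) (hk hw))).subset
    (shortRelators_mono φ hm)).area_le

theorem memF_spectrum [Finite X] (φ : FreeGroup X →* G) :
    MemF fun k m n => (spectrum φ k m n : ℝ) :=
  ⟨fun _ _ _ _ _ hk hm _ => Nat.cast_le.2 (spectrum_le_spectrum φ
      (Subgroup.normalClosure_mono (shortRelators_mono φ hk)) hm le_rfl le_rfl),
    fun _ _ _ _ _ hk hm _ => Nat.cast_le.2 (spectrum_le_spectrum φ le_rfl hk hm le_rfl),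
    fun _ _ _ _ _ hk _ hn => Nat.cast_le.2 (spectrum_le_spectrum φ le_rfl hk le_rfl hn)⟩

/-! ### Word length and change of generators -/

theorem wordLength_one : wordLength (1 : FreeGroup X) = 0 := by
  classical
  rw [wordLength_eq_norm, FreeGroup.norm_one]

theorem wordLength_inv (w : FreeGroup X) : wordLength w⁻¹ = wordLength w := by
  classical
  rw [wordLength_eq_norm, wordLength_eq_norm, FreeGroup.norm_inv_eq]

theorem wordLength_mul_le (u w : FreeGroup X) :
    wordLength (u * w) ≤ wordLength u + wordLength w := by
  classical
  simpa only [wordLength_eq_norm] using FreeGroup.norm_mul_le u w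

theorem wordLength_mk_singleton_le (a : X × Bool) : wordLength (FreeGroup.mk [a]) ≤ 1 := by
  classical
  rw [wordLength_eq_norm]
  exact FreeGroup.norm_mk_le

theorem wordLength_prod_le {T : Type*} {a : T → FreeGroup X} {D : ℕ} {p : List T}
    (h : ∀ t ∈ p, wordLength (a t) ≤ D) : wordLength (p.map a).prod ≤ D * p.length := by
  induction p with
  | nil => simp [wordLength_one]
  | cons t p ih =>
    rw [List.map_cons, List.prod_cons, List.length_cons, mul_add, mul_one, add_comm]
    exact (wordLength_mul_le _ _).trans (add_le_add (h t List.mem_cons_self)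
      (ih fun t ht => h t (List.mem_cons_of_mem _ ht)))

/-- The reduced word of `w`, as a product of single letters. -/
theorem exists_list_prod_eq (w : FreeGroup X) :
    ∃ p : List (X × Bool), (p.map fun t => FreeGroup.mk [t]).prod = w ∧
      p.length = wordLength w := by
  classical
  refine ⟨w.toWord, ?_, (wordLength_eq_norm w).symm⟩
  have (p : List (X × Bool)) : (p.map fun t => FreeGroup.mk [t]).prod = FreeGroup.mk p := by
    induction p with
    | nil => rfl
    | cons t p ih => rw [List.map_cons, List.prod_cons, ih, ← mk_cons]
  rw [this, FreeGroup.mk_toWord]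

theorem wordLength_map_letter_le {α : FreeGroup X →* FreeGroup Y} {C : ℕ}
    (h : ∀ x, wordLength (α (FreeGroup.of x)) ≤ C) (t : X × Bool) :
    wordLength (α (FreeGroup.mk [t])) ≤ C := by
  obtain ⟨x, _ | _⟩ := t
  · have : FreeGroup.mk [(x, false)] = (FreeGroup.of x)⁻¹ := rfl
    rw [this, map_inv, wordLength_inv]
    exact h x
  · exact h x

theorem wordLength_map_le {α : FreeGroup X →* FreeGroup Y} {C : ℕ}
    (h : ∀ x, wordLength (α (FreeGroup.of x)) ≤ C) (w : FreeGroup X) :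
    wordLength (α w) ≤ C * wordLength w := by
  obtain ⟨p, hp, hl⟩ := exists_list_prod_eq w
  rw [← hl, ← hp, map_list_prod, List.map_map]
  exact wordLength_prod_le fun t _ => wordLength_map_letter_le h t

/-- Rewriting words in one generating set of `G` as words in another one. -/
theorem exists_lift_of_surjective [Finite X] (φ : FreeGroup X →* G) {ψ : FreeGroup Y →* G}
    (hψ : Function.Surjective ψ) : ∃ (α : FreeGroup X →* FreeGroup Y) (C : ℕ),
      (∀ w, ψ (α w) = φ w) ∧ ∀ x, wordLength (α (FreeGroup.of x)) ≤ C := by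
  choose s hs using hψ
  obtain ⟨C, hC⟩ := (Set.finite_range fun x => wordLength (s (φ (FreeGroup.of x)))).bddAbove
  refine ⟨FreeGroup.lift fun x => s (φ (FreeGroup.of x)), C, fun w => ?_, fun x => ?_⟩
  · refine DFunLike.congr_fun (f := ψ.comp _) (g := φ) (FreeGroup.ext_hom _ _ fun x => ?_) w
    simp [hs]
  · rw [FreeGroup.lift_apply_of]
    exact hC ⟨x, rfl⟩

/-! ### Cutting words into short relators -/

/-- Two words that agree in `G` token by token differ by few short relators. Cutting both into blocks of
`m` tokens, with partial products `a₁ ⋯ aₛ` and `b₁ ⋯ bₛ`, the quotient is a product of conjugates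
of the `aᵢ bᵢ⁻¹`. -/
theorem areaLE_prod_mul_inv_prod (φ : FreeGroup X →* G) {T : Type*} {a b : T → FreeGroup X}
    {D m : ℕ} (hm : 1 ≤ m) (p : List T) (hφ : ∀ t ∈ p, φ (a t) = φ (b t))
    (ha : ∀ t ∈ p, wordLength (a t) ≤ D) (hb : ∀ t ∈ p, wordLength (b t) ≤ D) :
    AreaLE (shortRelators φ (2 * D * m)) ((p.map a).prod * (p.map b).prod⁻¹)
      (p.length / m + 1) := by
  induction hN : p.length using Nat.strong_induction_on generalizing p with
  | _ N ih =>
    have short (q : List T) (hq : q ⊆ p) (hqm : q.length ≤ m) :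
        AreaLE (shortRelators φ (2 * D * m)) ((q.map a).prod * (q.map b).prod⁻¹) 1 := by
      refine AreaLE.of_mem ⟨?_, ?_⟩
      · rw [map_mul, map_inv, mul_inv_eq_one, map_list_prod, map_list_prod, List.map_map,
          List.map_map]
        exact congrArg _ (List.map_congr_left fun t ht => hφ t (hq ht))
      · refine (wordLength_mul_le _ _).trans ?_
        rw [wordLength_inv]
        have h1 := wordLength_prod_le fun t ht => ha t (hq ht)
        have h2 := wordLength_prod_le fun t ht => hb t (hq ht)
        have h3 := Nat.mul_le_mul_left D hqm
        have h4 : 2 * D * m = D * m + D * m := by ring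
        omega
    by_cases hlt : p.length < m
    · exact (short p (List.Subset.refl p) hlt.le).mono (Nat.le_add_left _ _)
    · have h1 := short (p.take m) (List.take_subset m p) (List.length_take_le m p)
      have hd : (p.drop m).length = N - m := by rw [List.length_drop, hN]
      have h2 := ih (N - m) (by omega) (p.drop m) (fun t ht => hφ t (List.mem_of_mem_drop ht))
        (fun t ht => ha t (List.mem_of_mem_drop ht)) (fun t ht => hb t (List.mem_of_mem_drop ht))
        hd
      have h3 := (h2.conj ((p.take m).map a).prod⁻¹).mul h1
      have e : N / m = (N - m) / m + 1 := Nat.div_eq_sub_div hm (by omega)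
      rw [e]
      convert h3 using 1
      conv_lhs => rw [← List.take_append_drop m p]
      simp only [List.map_append, List.prod_append]
      group

/-- Rewriting `w` in another generating set and back changes it by `‖w‖ / m + 1` relators of length
`O(m)`. -/
theorem areaLE_mul_inv_map {φ : FreeGroup X →* G} {γ : FreeGroup X →* FreeGroup X}
    (hγ : ∀ w, φ (γ w) = φ w) {C : ℕ} (hC : 1 ≤ C)
    (hγC : ∀ x, wordLength (γ (FreeGroup.of x)) ≤ C) {m : ℕ} (hm : 1 ≤ m) (w : FreeGroup X) :
    AreaLE (shortRelators φ (2 * C * m)) (w * (γ w)⁻¹) (wordLength w / m + 1) := by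
  obtain ⟨p, hp, hl⟩ := exists_list_prod_eq w
  have h := areaLE_prod_mul_inv_prod φ (a := fun t : X × Bool => FreeGroup.mk [t])
    (b := fun t => γ (FreeGroup.mk [t])) hm p (fun t _ => (hγ _).symm)
    (fun t _ => (wordLength_mk_singleton_le t).trans hC)
    (fun t _ => wordLength_map_letter_le hγC t)
  rw [← hl]
  convert h using 2
  · exact hp.symm
  · rw [← hp, map_list_prod, List.map_map]; rfl

theorem evalTokens_eq_prod {I : Type*} (σ : I → FreeGroup X) (p : List ((X ⊕ I) × Bool)) :
    evalTokens σ p = (p.map fun t => evalTokens σ [t]).prod := by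
  induction p with
  | nil => rfl
  | cons t p ih => rw [evalTokens_cons, ih, List.map_cons, List.prod_cons]

/-- A word of area `l` is a product of `O((l + ‖w‖) / m) + 1` conjugates of relators of length `O(m)`: cut
the short spelling of `exists_short_tokens` into blocks, and compare it with its erasure. -/
theorem areaLE_shortRelators_of_isProductOfConjugates (ψ : FreeGroup X →* G)
    {R : Set (FreeGroup X)} (hψ : ∀ r ∈ R, ψ r = 1) {M : ℕ} (hM : ∀ r ∈ R, wordLength r ≤ M)
    {w : FreeGroup X} {l m : ℕ} (h : IsProductOfConjugates R w l) (hm : 1 ≤ m) :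
    AreaLE (shortRelators ψ (2 * (M + 1) * m)) w
      (((M + 1) * l + wordLength w) / m + 1) := by
  obtain ⟨p, hp, hp1, hl, hpR⟩ := exists_short_tokens h hM
  have h := areaLE_prod_mul_inv_prod ψ (a := fun t => evalTokens id [t])
    (b := fun t => evalTokens (1 : FreeGroup X → FreeGroup X) [t]) (D := M + 1) hm p ?_ ?_ ?_
  · rw [← evalTokens_eq_prod, ← evalTokens_eq_prod, hp, hp1, inv_one, mul_one] at h
    exact h.mono (Nat.add_le_add_right (Nat.div_le_div_right hl) 1)
  · rintro ⟨x | r, b⟩ ht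
    · simp only [evalTokens_inl]
    · cases b <;> simp [evalTokens_inr, hψ r (hpR r _ ht)]
  · rintro ⟨x | r, b⟩ ht
    · simp only [evalTokens_inl]
      exact (wordLength_mk_singleton_le _).trans (Nat.le_add_left _ _)
    · have := hM r (hpR r _ ht)
      cases b <;> simp [evalTokens_inr, wordLength_inv] <;> omega
  · rintro ⟨x | r, b⟩ ht
    · simp only [evalTokens_inl]
      exact (wordLength_mk_singleton_le _).trans (Nat.le_add_left _ _)
    · cases b <;> simp [evalTokens_inr, wordLength_one]

/-! ### Comparison of the spectrum with the Dehn function -/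

theorem image_shortRelators_subset {φ : FreeGroup X →* G} {ψ : FreeGroup Y →* G}
    {α : FreeGroup X →* FreeGroup Y} (hα : ∀ w, ψ (α w) = φ w) {C : ℕ}
    (hC : ∀ x, wordLength (α (FreeGroup.of x)) ≤ C) {k l : ℕ} (hl : C * k ≤ l) :
    α '' shortRelators φ k ⊆ shortRelators ψ l := by
  rintro _ ⟨w, ⟨hw, hk⟩, rfl⟩
  exact ⟨by rw [hα, hw],
    (wordLength_map_le hC w).trans ((Nat.mul_le_mul_left C hk).trans hl)⟩

/-- The upper bound for the area with respect to `𝒮_{Km}`, for an arbitrary finite generating set `X` and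
the Dehn function of an arbitrary finite presentation. -/
theorem exists_areaLE_shortRelators [Finite X] {φ : FreeGroup X →* G}
    (hφ : Function.Surjective φ) {ψ : FreeGroup Y →* G} {R : Set (FreeGroup Y)}
    (hψ : IsFinitePresentation ψ R) :
    ∃ K : ℕ, 1 ≤ K ∧ ∀ w, φ w = 1 → ∀ m, 1 ≤ m → AreaLE (shortRelators φ (K * m)) w
      ((K * dehn R (K * wordLength w) + K * wordLength w) / m + 2) := by
  obtain ⟨hY, hR, hψs, hker⟩ := hψ
  obtain ⟨M, hM⟩ : ∃ M, ∀ r ∈ R, wordLength r ≤ M := by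
    obtain ⟨M, hM⟩ := (hR.image wordLength).bddAbove
    exact ⟨M, fun r hr => hM ⟨r, hr, rfl⟩⟩
  obtain ⟨α, A, hα, hA⟩ := exists_lift_of_surjective φ hψs
  obtain ⟨β, B, hβ, hB⟩ := exists_lift_of_surjective ψ hφ
  have hBA (x) : wordLength ((β.comp α) (FreeGroup.of x)) ≤ B * A + 1 :=
    ((wordLength_map_le hB _).trans (Nat.mul_le_mul_left B (hA x))).trans (Nat.le_succ _)
  obtain ⟨K, h1, h2, h3, h4⟩ : ∃ K, M + 1 ≤ K ∧ A + 1 ≤ K ∧ B * (2 * (M + 1)) ≤ K ∧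
      2 * (B * A + 1) ≤ K :=
    ⟨(M + 1) + (A + 1) + B * (2 * (M + 1)) + 2 * (B * A + 1), by omega, by omega, by omega,
      by omega⟩
  refine ⟨K, by omega, fun w hw m hm => ?_⟩
  have hαker : α w ∈ Subgroup.normalClosure R := by
    rw [← hker, MonoidHom.mem_ker, hα, hw]
  have hαlen : wordLength (α w) ≤ A * wordLength w := wordLength_map_le hA w
  have key := (areaLE_shortRelators_of_isProductOfConjugates ψ
    (fun r hr => by
      rw [← MonoidHom.mem_ker, hker]; exact Subgroup.subset_normalClosure hr) hM
    (isProductOfConjugates_area hαker) hm).map β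
  replace key := key.subset (image_shortRelators_subset hβ hB (l := K * m)
    (by rw [← mul_assoc]; exact Nat.mul_le_mul_right m h3))
  have key' := (areaLE_mul_inv_map (φ := φ) (γ := β.comp α)
    (fun w => by rw [MonoidHom.comp_apply, hβ, hα]) (Nat.le_add_left 1 _) hBA hm w).subset
    (shortRelators_mono φ (Nat.mul_le_mul_right m h4))
  have := key'.mul key
  rw [MonoidHom.comp_apply, inv_mul_cancel_right] at this
  refine this.mono ?_
  have hd : area R (α w) ≤ dehn R (K * wordLength w) :=
    area_le_dehn hαker (hαlen.trans (Nat.mul_le_mul_right _ (by omega)))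
  have e1 : (M + 1) * area R (α w) ≤ K * dehn R (K * wordLength w) := Nat.mul_le_mul h1 hd
  have e2 : (A + 1) * wordLength w ≤ K * wordLength w := Nat.mul_le_mul_right _ h2
  have e3 : wordLength w / m + ((M + 1) * area R (α w) + wordLength (α w)) / m ≤
      (K * dehn R (K * wordLength w) + K * wordLength w) / m := by
    refine (Nat.div_add_div_le_add_div).trans (Nat.div_le_div_right ?_)
    rw [add_mul, one_mul] at e2
    omega
  omega

/-- Finite presentability does not depend on the finite generating set: all relations follow from those
of bounded length. -/
theorem exists_ker_eq_normalClosure_shortRelators [Finite X] {φ : FreeGroup X →* G}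
    (hφ : Function.Surjective φ) {ψ : FreeGroup Y →* G} {R : Set (FreeGroup Y)}
    (hψ : IsFinitePresentation ψ R) :
    ∃ K : ℕ, 1 ≤ K ∧ Subgroup.normalClosure (shortRelators φ K) = φ.ker := by
  obtain ⟨K, hK, h⟩ := exists_areaLE_shortRelators hφ hψ
  refine ⟨K, hK, le_antisymm (normalClosure_shortRelators_le_ker φ K) fun w hw => ?_⟩
  have := (h w hw 1 le_rfl).mem_normalClosure
  rwa [mul_one] at this

/-- Adding a trivial generator yields a relator of length `1`, so the Dehn function is positive already
at `1`. -/
theorem exists_finite_presentation_dehn_pos {d : ℕ} {ψ : FreeGroup (Fin d) →* G}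
    {R : Set (FreeGroup (Fin d))} (hψ : IsFinitePresentation ψ R) :
    ∃ (d : ℕ) (ψ : FreeGroup (Fin d) →* G) (R : Set (FreeGroup (Fin d))),
      IsFinitePresentation ψ R ∧ ∀ n : ℕ, 1 ≤ n → 0 < dehn R n := by
  let φ : FreeGroup (Fin (d + 1)) →* G :=
    FreeGroup.lift (Fin.lastCases 1 fun i => ψ (FreeGroup.of i))
  have hφs : Function.Surjective φ := by
    intro g
    obtain ⟨w, rfl⟩ := hψ.2.2.1 g
    refine ⟨FreeGroup.map Fin.castSucc w, ?_⟩
    refine DFunLike.congr_fun (f := φ.comp (FreeGroup.map Fin.castSucc)) (g := ψ)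
      (FreeGroup.ext_hom _ _ fun i => ?_) w
    simp [φ]
  obtain ⟨K, hK, hker⟩ := exists_ker_eq_normalClosure_shortRelators hφs hψ
  refine ⟨d + 1, φ, shortRelators φ K, ⟨inferInstance,
    (finite_wordLength_le K).subset fun w hw => hw.2, hφs, hker.symm⟩, fun n hn => ?_⟩
  have hlast : FreeGroup.of (Fin.last d) ∈ Subgroup.normalClosure (shortRelators φ K) := by
    rw [hker, MonoidHom.mem_ker]
    simp [φ]
  exact (area_pos hlast (FreeGroup.of_ne_one _)).trans_le
    (area_le_dehn hlast ((wordLength_mk_singleton_le _).trans hn))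

/-- If all relations follow from those of length at most `K`, then replacing `k` by `K` does not change
the spectrum up to equivalence. -/
theorem essentiallyIndependent_spectrum [Finite X] {φ : FreeGroup X →* G} {K : ℕ} (hK : 1 ≤ K)
    (hker : Subgroup.normalClosure (shortRelators φ K) = φ.ker) :
    EssentiallyIndependent fun k m n => (spectrum φ k m n : ℝ) := by
  have hle {k k' : ℕ} (hk : K ≤ k') : Subgroup.normalClosure (shortRelators φ k) ≤
      Subgroup.normalClosure (shortRelators φ k') :=
    (normalClosure_shortRelators_le_ker φ k).trans
      (hker.symm.le.trans (Subgroup.normalClosure_mono (shortRelators_mono φ hk)))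
  have hextra (m n : ℕ) : (0 : ℝ) ≤ K * ((n : ℝ) / m) := by positivity
  have hmul {a b : ℕ} (h : a ≤ b) : (a : ℝ) ≤ K * b :=
    (Nat.cast_le.2 h).trans (le_mul_of_one_le_left (Nat.cast_nonneg b) (Nat.one_le_cast.2 hK))
  -- The maximum with `K` is needed because the spectrum at `(K, m, n)` is only meaningful for `m ≥ K`.
  refine ⟨memF_spectrum φ, fun m n => spectrum φ K (max m K) n, ⟨?_, ?_, ?_⟩,
    ⟨K, hK, ?_⟩, ⟨K, hK, ?_⟩⟩
  · intros; exact le_rfl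
  · intro _ m m' n _ _ hm _
    exact Nat.cast_le.2 (spectrum_le_spectrum φ le_rfl (le_max_right _ _)
      (max_le_max_right K hm) le_rfl)
  · intro _ m n n' _ _ _ hn
    exact Nat.cast_le.2 (spectrum_le_spectrum φ le_rfl (le_max_right _ _) le_rfl hn)
  · intro k m n hk hm hn hkm
    have h : spectrum φ k (K * m) n ≤ spectrum φ K (max m K) (K * n) :=
      spectrum_le_spectrum φ (hle le_rfl) (le_max_right _ _)
        (max_le (Nat.le_mul_of_pos_left m hK) (Nat.le_mul_of_pos_right K hm))
        (Nat.le_mul_of_pos_left n hK)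
    have := hmul h
    have := hextra m n
    have : (0 : ℝ) ≤ K := Nat.cast_nonneg K
    linarith
  · intro k m n hk hm hn hkm
    have h : spectrum φ K (max (K * m) K) n ≤ spectrum φ (K * k) m (K * n) :=
      spectrum_le_spectrum φ (hle (Nat.le_mul_of_pos_right K hk)) hkm
        (le_max_of_le_left (Nat.le_mul_of_pos_left m hK)) (Nat.le_mul_of_pos_left n hK)
    have := hmul h
    have := hextra m n
    have : (0 : ℝ) ≤ K := Nat.cast_nonneg K
    linarith

/-- The lower bound: a decomposition over `𝒮_m` is refined by filling each factor, of length `O(m)`,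
with at most `δ(Km)` relators. -/
theorem preceq_spectrum [Finite X] {φ : FreeGroup X →* G} (hφ : Function.Surjective φ)
    {ψ : FreeGroup Y →* G} {R : Set (FreeGroup Y)} (hψ : IsFinitePresentation ψ R)
    (hpos : ∀ n : ℕ, 1 ≤ n → 0 < dehn R n) :
    Preceq (fun _ m n => (dehn R n : ℝ) / (dehn R m : ℝ))
      (fun k m n => (spectrum φ k m n : ℝ)) := by
  obtain ⟨K₀, -, hker₀⟩ := exists_ker_eq_normalClosure_shortRelators hφ hψ
  obtain ⟨hY, hR, hψs, hker⟩ := hψ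
  obtain ⟨α, A, hα, hA⟩ := exists_lift_of_surjective φ hψs
  obtain ⟨β, B, hβ, hB⟩ := exists_lift_of_surjective ψ hφ
  have hAB (y) : wordLength ((α.comp β) (FreeGroup.of y)) ≤ A * B + 1 :=
    ((wordLength_map_le hA _).trans (Nat.mul_le_mul_left A (hB y))).trans (Nat.le_succ _)
  obtain ⟨K, h1, h2, h3, h4⟩ : ∃ K, K₀ ≤ K ∧ A ≤ K ∧ B ≤ K ∧ 2 * (A * B + 1) ≤ K :=
    ⟨K₀ + A + B + 2 * (A * B + 1), by omega, by omega, by omega, by omega⟩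
  have hK : 1 ≤ K := by omega
  refine ⟨K, hK, fun k m n hk hm hn hkm => ?_⟩
  have hbound : dehn R n ≤ (n / m + 1 + spectrum φ (K * k) m (K * n)) * dehn R (K * m) := by
    refine dehn_le fun w hw hwn => AreaLE.area_le (AreaLE.trans (S := shortRelators ψ (K * m)) ?_
      fun s hs => (areaLE_area ?_).mono (area_le_dehn ?_ hs.2))
    · have hψw : ψ w = 1 := by rwa [← MonoidHom.mem_ker, hker]
      have hβw : β w ∈ Subgroup.normalClosure (shortRelators φ (K * k)) := by
        refine Subgroup.normalClosure_mono
          (shortRelators_mono φ (h1.trans (Nat.le_mul_of_pos_right K hk))) ?_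
        rw [hker₀, MonoidHom.mem_ker, hβ, hψw]
      have hβlen : wordLength (β w) ≤ K * n :=
        (wordLength_map_le hB w).trans (Nat.mul_le_mul h3 hwn)
      have key := (((areaLE_area (Subgroup.normalClosure_mono (shortRelators_mono φ hkm) hβw)).mono
        (area_le_spectrum φ m hβw hβlen)).map α).subset
        (image_shortRelators_subset hα hA (Nat.mul_le_mul_right m h2))
      have key' := (areaLE_mul_inv_map (φ := ψ) (γ := α.comp β)
        (fun w => by rw [MonoidHom.comp_apply, hα, hβ]) (Nat.le_add_left 1 _) hAB hm w).subset
        (shortRelators_mono ψ (Nat.mul_le_mul_right m h4))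
      have := key'.mul key
      rw [MonoidHom.comp_apply, inv_mul_cancel_right] at this
      exact this.mono (Nat.add_le_add_right
        (Nat.add_le_add_right (Nat.div_le_div_right hwn) 1) _)
    all_goals
      rw [← hker]; exact hs.1
  have hδ : (0 : ℝ) < dehn R (K * m) := Nat.cast_pos.2 (hpos _ (Nat.mul_pos hK hm))
  have hK' : (1 : ℝ) ≤ K := Nat.one_le_cast.2 hK
  have hdiv : ((n / m : ℕ) : ℝ) ≤ K * ((n : ℝ) / m) :=
    Nat.cast_div_le.trans (le_mul_of_one_le_left (by positivity) hK')
  have hspec : (spectrum φ (K * k) m (K * n) : ℝ) ≤ K * spectrum φ (K * k) m (K * n) :=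
    le_mul_of_one_le_left (Nat.cast_nonneg _) hK'
  have hbound' : (dehn R n : ℝ) ≤
      ((n / m : ℕ) + 1 + spectrum φ (K * k) m (K * n)) * dehn R (K * m) := by
    exact_mod_cast hbound
  refine ((div_le_iff₀ hδ).2 hbound').trans ?_
  linarith

theorem spectrum_preceq [Finite X] {φ : FreeGroup X →* G} (hφ : Function.Surjective φ)
    {ψ : FreeGroup Y →* G} {R : Set (FreeGroup Y)} (hψ : IsFinitePresentation ψ R) :
    Preceq (fun k m n => (spectrum φ k m n : ℝ)) (fun _ m n => (dehn R n : ℝ) / (m : ℝ)) := by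
  obtain ⟨K, hK, h⟩ := exists_areaLE_shortRelators hφ hψ
  have := hψ.1
  refine ⟨K + 1, Nat.le_add_left _ _, fun k m n hk hm hn hkm => ?_⟩
  have hle : spectrum φ k ((K + 1) * m) n ≤
      (K * dehn R ((K + 1) * n) + K * n) / m + 2 := by
    refine spectrum_le fun w hw hwn => AreaLE.area_le ?_
    refine ((h w (normalClosure_shortRelators_le_ker φ k hw) m hm).subset
      (shortRelators_mono φ (Nat.mul_le_mul_right m (Nat.le_succ K)))).mono
      (Nat.add_le_add_right (Nat.div_le_div_right (add_le_add (Nat.mul_le_mul_left K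
        (dehn_mono R ?_)) (Nat.mul_le_mul_left K hwn))) 2)
    exact Nat.mul_le_mul (Nat.le_succ K) hwn
  have hle' : (spectrum φ k ((K + 1) * m) n : ℝ) ≤
      ((K * dehn R ((K + 1) * n) + K * n : ℕ) : ℝ) / m + 2 :=
    (Nat.cast_le.2 hle).trans (by
      push_cast
      exact add_le_add_left (by exact_mod_cast Nat.cast_div_le) 2)
  refine hle'.trans ?_
  have hK' : (1 : ℝ) ≤ K := Nat.one_le_cast.2 hK
  have p1 : (0 : ℝ) ≤ (dehn R ((K + 1) * n) : ℝ) / m := by positivity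
  have p2 : (0 : ℝ) ≤ (n : ℝ) / m := by positivity
  push_cast
  rw [add_div, mul_div_assoc, mul_div_assoc]
  nlinarith

end IsoSpectrum

theorem theorem1p4 {G : Type*} [Group G] [Group.IsFinitelyPresented G] :
    (∃ (d : ℕ) (ψ : FreeGroup (Fin d) →* G) (R : Set (FreeGroup (Fin d))),
      IsoSpectrum.IsFinitePresentation ψ R ∧ ∀ n : ℕ, 1 ≤ n → 0 < IsoSpectrum.dehn R n) ∧
    ∀ (X : Type*) [Finite X] (φ : FreeGroup X →* G), Function.Surjective φ →
      IsoSpectrum.EssentiallyIndependent (fun k m n => (IsoSpectrum.spectrum φ k m n : ℝ)) ∧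
      ∀ (Y : Type*) (ψ : FreeGroup Y →* G) (R : Set (FreeGroup Y)),
        IsoSpectrum.IsFinitePresentation ψ R →
        (∀ n : ℕ, 1 ≤ n → 0 < IsoSpectrum.dehn R n) →
        IsoSpectrum.Preceq
          (fun _ m n => (IsoSpectrum.dehn R n : ℝ) / (IsoSpectrum.dehn R m : ℝ))
          (fun k m n => (IsoSpectrum.spectrum φ k m n : ℝ)) ∧
        IsoSpectrum.Preceq
          (fun k m n => (IsoSpectrum.spectrum φ k m n : ℝ))
          (fun _ m n => (IsoSpectrum.dehn R n : ℝ) / (m : ℝ)) := by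
  obtain ⟨d, ψ₀, hψ₀, R₀, hR₀, hker⟩ := Group.IsFinitelyPresented.out (G := G)
  have hpres : IsoSpectrum.IsFinitePresentation ψ₀ R₀ := ⟨inferInstance, hR₀, hψ₀, hker.symm⟩
  refine ⟨IsoSpectrum.exists_finite_presentation_dehn_pos hpres, fun X _ φ hφ => ⟨?_,
    fun Y ψ R hψ hpos => ⟨IsoSpectrum.preceq_spectrum hφ hψ hpos,
      IsoSpectrum.spectrum_preceq hφ hψ⟩⟩⟩
  obtain ⟨K, hK, hK'⟩ := IsoSpectrum.exists_ker_eq_normalClosure_shortRelators hφ hpres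
  exact IsoSpectrum.essentiallyIndependent_spectrum hK hK'
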